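/- All graphs are finite and simple. For a connected graph $G$, a sequence $(x_1,\dots,x_k)$ of vertices is a burning sequence of length $k$ if the following process burns all vertices of $G$ in exactly $k$ rounds: initially no vertex is burned; in round $r\ge 1$, the vertex $x_r$, which must be unburned at the beginning of round $r$, becomes burned, together with every vertex adjacent to a vertex that was burned before round $r$; burned vertices remain burned. The burning number $b(G)$ is the minimum length of a burning sequence for $G$. Let $T$ be a tree of order $n$ with at most $\lfloor\sqrt{n-1}\rfloor$ vertices of degree $2$. Then $b(T)\le\lceil\sqrt n\,\rceil$. -/

import Mathlib

namespace SimpleGraph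

/-- The set of vertices of `G` that are burned after the first `r` rounds when the entries of `s`
are used, in order, as sources (`s[r]?` is the source of round `r + 1`). In each round the source
of the round and all neighbours of already burned vertices are burned; burned vertices stay
burned. -/
def burnedAfter {V : Type*} (G : SimpleGraph V) (s : List V) : ℕ → Set V
  | 0 => ∅
  | r + 1 => G.burnedAfter s r ∪ {v | s[r]? = some v} ∪ {v | ∃ u ∈ G.burnedAfter s r, G.Adj u v}

/-- `s = (x₁, …, x_k)` is a burning sequence for `G`: each source is unburned at the beginning of
its round, and all vertices are burned after round `k`. (As `x_k` is unburned before round `k`,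
the process does not terminate in an earlier round.) -/
structure IsBurningSequence {V : Type*} (G : SimpleGraph V) (s : List V) : Prop where
  source_unburned : ∀ (r : ℕ) (hr : r < s.length), s[r] ∉ G.burnedAfter s r
  all_burned : G.burnedAfter s s.length = Set.univ

/-- The burning number of `G`: the minimum length of a burning sequence for `G`
(it is `⊤` if there is no burning sequence). -/
noncomputable def burningNumber {V : Type*} (G : SimpleGraph V) : ℕ∞ :=
  ⨅ (s : List V) (_ : G.IsBurningSequence s), (s.length : ℕ∞)

end SimpleGraph

/-!
A connected graph burns in at most `m` rounds if balls of radii `0, …, m - 1` cover it: ignite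
the centres in order of decreasing radius, and whenever a centre is already burned, ignite any
unburned vertex instead.

Let `par` send each vertex of a connected graph to the next vertex on a shortest path to a fixed
root. Every vertex is adjacent or equal to a vertex of the range of `par`, so it suffices to cover
this range by balls of radii `0, …, m - 2`. A finite set closed under `par` can be peeled: the
descendants of the `r`-th ancestor of a deepest vertex lie in a ball of radius `r`, number at least
`r + 1` (unless they are the whole set), and their removal leaves a set closed under `par`. Peel
with the radii `0, …, m - 3`; the gain comes from spending the largest radius last, because a ball
of radius `r` covers any closed set of at most `2 * r + 1` vertices. The vertices in the range of
`par` have degree at least `2` if the root has, and counting edges bounds the number of those in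
terms of the number of vertices of degree exactly `2`.
-/

namespace GraphBurning

open Finset SimpleGraph

variable {V : Type*} {G : SimpleGraph V}

section Burning

theorem burnedAfter_mono (s : List V) : Monotone (G.burnedAfter s) :=
  monotone_nat_of_le_succ fun _ _ hx => Or.inl (Or.inl hx)

theorem burnedAfter_append (s t : List V) {r : ℕ} (hr : r ≤ s.length) :
    G.burnedAfter (s ++ t) r = G.burnedAfter s r := by
  induction r with
  | zero => rfl
  | succ r ih =>
    simp only [burnedAfter, ih (Nat.le_of_succ_le hr), List.getElem?_append_left hr]

theorem mem_burnedAfter_concat (s : List V) (x : V) :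
    x ∈ G.burnedAfter (s ++ [x]) (s.length + 1) :=
  Or.inl (Or.inr List.getElem?_concat_length)

theorem mem_burnedAfter_add_length {s : List V} {u v : V} (p : G.Walk u v) {a : ℕ}
    (hu : u ∈ G.burnedAfter s a) : v ∈ G.burnedAfter s (a + p.length) := by
  induction p generalizing a with
  | nil => exact hu
  | cons hadj p ih =>
    rw [Walk.length_cons, Nat.add_comm p.length, ← Nat.add_assoc]
    exact ih (Or.inr ⟨_, hu, hadj⟩)

theorem mem_burnedAfter_of_dist_le {s : List V} {u v : V} (huv : G.Reachable u v) {a b : ℕ}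
    (hu : u ∈ G.burnedAfter s a) (hab : a + G.dist u v ≤ b) : v ∈ G.burnedAfter s b := by
  obtain ⟨p, hp⟩ := huv.exists_walk_length_eq_dist
  exact burnedAfter_mono s (hp ▸ hab) (mem_burnedAfter_add_length p hu)

/-- A partial burning sequence: no source is burned before its round, but vertices may still be
unburned at the end. Burning sequences are built by extending partial ones. -/
def IsPartialBurningSequence (G : SimpleGraph V) (s : List V) : Prop :=
  ∀ (r : ℕ) (hr : r < s.length), s[r] ∉ G.burnedAfter s r

theorem IsPartialBurningSequence.concat {s : List V} (hs : IsPartialBurningSequence G s) {x : V}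
    (hx : x ∉ G.burnedAfter s s.length) : IsPartialBurningSequence G (s ++ [x]) := by
  intro r hr
  rw [List.length_append, List.length_singleton] at hr
  rw [burnedAfter_append _ _ (Nat.le_of_lt_succ hr)]
  rcases Nat.lt_succ_iff_lt_or_eq.1 hr with hlt | rfl
  · rw [List.getElem_append_left hlt]
    exact hs r hlt
  · rwa [List.getElem_concat_length rfl]

theorem IsPartialBurningSequence.exists_concat {s : List V} (hs : IsPartialBurningSequence G s)
    (hunburned : G.burnedAfter s s.length ≠ Set.univ) (y : V) :
    ∃ x, IsPartialBurningSequence G (s ++ [x]) ∧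
      y ∈ G.burnedAfter (s ++ [x]) (s.length + 1) := by
  by_cases hy : y ∈ G.burnedAfter s s.length
  · obtain ⟨x, hx⟩ := (Set.ne_univ_iff_exists_notMem _).1 hunburned
    refine ⟨x, hs.concat hx, burnedAfter_mono _ s.length.le_succ ?_⟩
    rwa [burnedAfter_append _ _ le_rfl]
  · exact ⟨y, hs.concat hy, mem_burnedAfter_concat s y⟩

theorem burningNumber_le_length {s : List V} (hs : G.IsBurningSequence s) :
    G.burningNumber ≤ s.length :=
  iInf₂_le s hs

theorem exists_isPartialBurningSequence_of_le_burningNumber (t : ℕ → V) {m : ℕ}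
    (hm : m ≤ G.burningNumber) :
    ∃ s : List V, s.length = m ∧ IsPartialBurningSequence G s ∧
      ∀ i < m, t i ∈ G.burnedAfter s (i + 1) := by
  induction m with
  | zero =>
    exact ⟨[], rfl, fun r hr => absurd hr r.not_lt_zero, fun i hi => absurd hi i.not_lt_zero⟩
  | succ m ih =>
    have hlt : (m : ℕ∞) < G.burningNumber := lt_of_lt_of_le (by exact_mod_cast m.lt_succ_self) hm
    obtain ⟨s, rfl, hs, ht⟩ := ih hlt.le
    have hunburned : G.burnedAfter s s.length ≠ Set.univ := fun hall =>
      (burningNumber_le_length ⟨hs, hall⟩).not_gt hlt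
    obtain ⟨x, hx, hmem⟩ := hs.exists_concat hunburned (t s.length)
    refine ⟨s ++ [x], by simp, hx, fun i hi => ?_⟩
    rcases Nat.lt_succ_iff_lt_or_eq.1 hi with hi | rfl
    · rw [burnedAfter_append _ _ hi]
      exact ht i hi
    · exact hmem

theorem burningNumber_le_of_forall_exists_dist_le (hG : G.Preconnected) (c : ℕ → V) {m : ℕ}
    (hc : ∀ x, ∃ i < m, G.dist (c i) x ≤ i) : G.burningNumber ≤ m := by
  by_contra! hlt
  obtain ⟨s, rfl, hs, ht⟩ :=
    exists_isPartialBurningSequence_of_le_burningNumber (fun i => c (m - 1 - i)) hlt.le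
  refine (burningNumber_le_length ⟨hs, Set.eq_univ_of_forall fun x => ?_⟩).not_gt hlt
  obtain ⟨i, hi, hx⟩ := hc x
  have hci := ht (s.length - 1 - i) (by omega)
  rw [show s.length - 1 - (s.length - 1 - i) = i by omega] at hci
  exact mem_burnedAfter_of_dist_le (hG _ _) hci (by omega)

end Burning

section ParentMap

theorem dist_lt_card_of_preconnected_induce {S : Finset V}
    (hS : (G.induce (S : Set V)).Preconnected) {u w : V} (hu : u ∈ S) (hw : w ∈ S) :
    G.dist u w < #S := by
  obtain ⟨p, hp⟩ := hS.exists_isPath ⟨u, hu⟩ ⟨w, hw⟩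
  calc G.dist u w ≤ (p.map (Embedding.induce _).toHom).length := dist_le _
    _ = p.length := p.length_map _
    _ < Fintype.card (S : Set V) := hp.length_lt
    _ = #S := Fintype.card_coe S

/-- `par` maps each vertex other than the root `ρ` to a neighbour which is one step closer to `ρ`:
it encodes a breadth-first spanning tree. The root is its own parent, so that all iterates of `par`
are meaningful. -/
structure IsParentMap (G : SimpleGraph V) (ρ : V) (par : V → V) : Prop where
  map_root : par ρ = ρ
  adj : ∀ ⦃x⦄, x ≠ ρ → G.Adj (par x) x
  dist_root : ∀ ⦃x⦄, x ≠ ρ → G.dist ρ x = G.dist ρ (par x) + 1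

theorem exists_adj_dist_eq_add_one (hG : G.Connected) {ρ x : V} (hx : x ≠ ρ) :
    ∃ y, G.Adj y x ∧ G.dist ρ x = G.dist ρ y + 1 := by
  obtain ⟨p, hp⟩ := hG.exists_walk_length_eq_dist x ρ
  cases p with
  | nil => exact absurd rfl hx
  | @cons _ y _ hadj p =>
    have hp_le : G.dist ρ y ≤ p.length := dist_comm (G := G) ▸ dist_le p
    have htri := hG.dist_triangle (u := ρ) (v := y) (w := x)
    rw [dist_eq_one_iff_adj.2 hadj.symm] at htri
    rw [Walk.length_cons, dist_comm] at hp
    exact ⟨y, hadj.symm, by omega⟩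

theorem exists_isParentMap (hG : G.Connected) (ρ : V) : ∃ par, IsParentMap G ρ par := by
  classical
  choose! par hadj hdist using fun x (hx : x ≠ ρ) => exists_adj_dist_eq_add_one hG hx
  refine ⟨Function.update par ρ ρ, Function.update_self .., fun x hx => ?_, fun x hx => ?_⟩
  all_goals rw [Function.update_of_ne hx]
  exacts [hadj x hx, hdist x hx]

open Classical in
/-- The vertices of `S` from which `v` is reached by iterating `par`. If `par` is a parent map,
they span the subtree of `S` below `v`. -/
noncomputable def descendants (par : V → V) (S : Finset V) (v : V) : Finset V :=
  {x ∈ S | ∃ i, par^[i] x = v}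

variable {ρ : V} {par : V → V} {S : Finset V}

theorem mem_descendants {v x : V} : x ∈ descendants par S v ↔ x ∈ S ∧ ∃ i, par^[i] x = v := by
  simp only [descendants, mem_filter]

theorem mapsTo_sdiff_descendants [DecidableEq V] (hS : Set.MapsTo par S S) (v : V) :
    Set.MapsTo par ↑(S \ descendants par S v) ↑(S \ descendants par S v) := by
  intro x hx
  rw [mem_coe, mem_sdiff] at hx ⊢
  refine ⟨hS hx.1, fun hpar => hx.2 ?_⟩
  obtain ⟨i, hi⟩ := (mem_descendants.1 hpar).2
  exact mem_descendants.2 ⟨hx.1, i + 1, hi⟩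

namespace IsParentMap

theorem dist_root_par (hpar : IsParentMap G ρ par) (x : V) :
    G.dist ρ (par x) = G.dist ρ x - 1 := by
  by_cases hx : x = ρ
  · rw [hx, hpar.map_root, dist_self]
  · rw [hpar.dist_root hx, Nat.add_sub_cancel]

theorem dist_par_le_one (hpar : IsParentMap G ρ par) (x : V) : G.dist (par x) x ≤ 1 := by
  by_cases hx : x = ρ
  · rw [hx, hpar.map_root, dist_self]
    exact zero_le_one
  · exact (dist_eq_one_iff_adj.2 (hpar.adj hx)).le

theorem dist_root_iterate (hpar : IsParentMap G ρ par) (x : V) (i : ℕ) :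
    G.dist ρ (par^[i] x) = G.dist ρ x - i := by
  induction i with
  | zero => rfl
  | succ i ih => rw [Function.iterate_succ_apply', hpar.dist_root_par, ih, Nat.sub_sub]

theorem dist_iterate_add_dist_root_le (hG : G.Connected) (hpar : IsParentMap G ρ par) (x : V)
    (i : ℕ) : G.dist (par^[i] x) x + G.dist ρ (par^[i] x) ≤ G.dist ρ x := by
  induction i with
  | zero => rw [Function.iterate_zero_apply, dist_self, Nat.zero_add]
  | succ i ih =>
    rw [Function.iterate_succ_apply']
    by_cases hroot : par^[i] x = ρ
    · rw [hroot] at ih ⊢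
      rwa [hpar.map_root]
    · have htri := hG.dist_triangle (u := par (par^[i] x)) (v := par^[i] x) (w := x)
      have := hpar.dist_par_le_one (par^[i] x)
      have := hpar.dist_root hroot
      omega

theorem iterate_dist_root (hG : G.Connected) (hpar : IsParentMap G ρ par) (x : V) :
    par^[G.dist ρ x] x = ρ := by
  rw [eq_comm, ← hG.dist_eq_zero_iff, hpar.dist_root_iterate, Nat.sub_self]

theorem preconnected_induce (hG : G.Connected) (hpar : IsParentMap G ρ par) {S : Set V}
    (hS : Set.MapsTo par S S) : (G.induce S).Preconnected := by
  have hreach (x : S) (i : ℕ) :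
      (G.induce S).Reachable x ⟨par^[i] x, hS.iterate i x.2⟩ := by
    induction i with
    | zero => exact Reachable.rfl
    | succ i ih =>
      simp only [Function.iterate_succ_apply']
      by_cases hroot : par^[i] x = ρ
      · simpa only [hroot, hpar.map_root] using ih
      · exact ih.trans (Adj.reachable (G := G.induce S) (hpar.adj hroot).symm)
  intro u w
  have hu := hreach u (G.dist ρ u)
  have hw := hreach w (G.dist ρ w)
  simp only [hpar.iterate_dist_root hG] at hu hw
  exact hu.trans hw.symm

theorem succ_le_card_descendants_iterate (hpar : IsParentMap G ρ par) (hS : Set.MapsTo par S S)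
    {x : V} (hx : x ∈ S) {r : ℕ} (hr : r ≤ G.dist ρ x) :
    r + 1 ≤ #(descendants par S (par^[r] x)) := by
  rw [← card_range (r + 1)]
  refine card_le_card_of_injOn (fun i => par^[i] x) (fun i hi => ?_) fun i hi j hj hij => ?_
  · have hir : i ≤ r := Nat.le_of_lt_succ (mem_range.1 hi)
    refine mem_descendants.2 ⟨hS.iterate i hx, r - i, ?_⟩
    rw [← Function.iterate_add_apply, Nat.sub_add_cancel hir]
  · have hdist : G.dist ρ (par^[i] x) = G.dist ρ (par^[j] x) := congrArg (G.dist ρ) hij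
    rw [hpar.dist_root_iterate, hpar.dist_root_iterate] at hdist
    rw [coe_range, Set.mem_Iio] at hi hj
    omega

theorem exists_card_sdiff_descendants_le [DecidableEq V] (hG : G.Connected)
    (hpar : IsParentMap G ρ par) (hS : Set.MapsTo par S S) (hne : S.Nonempty) (r : ℕ) :
    ∃ v ∈ S, (∀ y ∈ descendants par S v, G.dist v y ≤ r) ∧
      #(S \ descendants par S v) ≤ #S - (r + 1) := by
  obtain ⟨x, hx, hmax⟩ := S.exists_max_image (G.dist ρ) hne
  refine ⟨par^[r] x, hS.iterate r hx, fun y hy => ?_, ?_⟩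
  · obtain ⟨hyS, i, hi⟩ := mem_descendants.1 hy
    have hle := hpar.dist_iterate_add_dist_root_le hG y i
    rw [hi, hpar.dist_root_iterate] at hle
    have := hmax y hyS
    omega
  rcases le_total r (G.dist ρ x) with hr | hr
  · rw [card_sdiff_of_subset fun y hy => (mem_descendants.1 hy).1]
    exact Nat.sub_le_sub_left (hpar.succ_le_card_descendants_iterate hS hx hr) _
  · have hroot : par^[r] x = ρ := by
      rw [eq_comm, ← hG.dist_eq_zero_iff, hpar.dist_root_iterate, Nat.sub_eq_zero_of_le hr]
    have hsub : S ⊆ descendants par S ρ := fun y hy =>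
      mem_descendants.2 ⟨hy, _, hpar.iterate_dist_root hG y⟩
    rw [hroot, sdiff_eq_empty_iff_subset.2 hsub, card_empty]
    exact Nat.zero_le _

theorem mapsTo_insert_sdiff_descendants [DecidableEq V] (hpar : IsParentMap G ρ par)
    (hS : Set.MapsTo par S S) {v : V} (hv : v ∈ S) :
    Set.MapsTo par ↑(insert v (S \ descendants par S v)) ↑(insert v (S \ descendants par S v)) := by
  rw [coe_insert]
  rintro x (rfl | hx)
  · by_cases hx : x = ρ
    · exact Or.inl (by rw [hx, hpar.map_root])
    refine Or.inr (mem_sdiff.2 ⟨hS hv, fun hmem => ?_⟩)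
    obtain ⟨i, hi⟩ := (mem_descendants.1 hmem).2
    have hdist := hpar.dist_root_iterate (par x) i
    rw [hi, hpar.dist_root hx] at hdist
    omega
  · exact Or.inr (mapsTo_sdiff_descendants hS v hx)

theorem exists_forall_dist_le (hG : G.Connected) (hpar : IsParentMap G ρ par)
    (hS : Set.MapsTo par S S) {r : ℕ} (hcard : #S ≤ 2 * r + 1) :
    ∃ v, ∀ x ∈ S, G.dist v x ≤ r := by
  classical
  rcases S.eq_empty_or_nonempty with rfl | hne
  · exact ⟨ρ, fun x hx => absurd hx (notMem_empty x)⟩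
  obtain ⟨v, hv, hball, hrest⟩ := hpar.exists_card_sdiff_descendants_le hG hS hne r
  refine ⟨v, fun y hy => ?_⟩
  by_cases hyv : y ∈ descendants par S v
  · exact hball y hyv
  have hlt := dist_lt_card_of_preconnected_induce
    (hpar.preconnected_induce hG (hpar.mapsTo_insert_sdiff_descendants hS hv))
    (mem_insert_self _ _) (mem_insert_of_mem (mem_sdiff.2 ⟨hy, hyv⟩))
  have := card_insert_le v (S \ descendants par S v)
  omega

theorem exists_centers_dist_le {ι : Type*} [DecidableEq ι] (hG : G.Connected)
    (hpar : IsParentMap G ρ par) (r : ι → ℕ) {i₀ : ι} {t : Finset ι} (hi₀ : i₀ ∉ t)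
    (hS : Set.MapsTo par S S) (hcard : #S ≤ ∑ i ∈ t, (r i + 1) + (2 * r i₀ + 1)) :
    ∃ c : ι → V, ∀ x ∈ S, ∃ i ∈ insert i₀ t, G.dist (c i) x ≤ r i := by
  classical
  induction t using Finset.induction_on generalizing S with
  | empty =>
    rw [sum_empty, Nat.zero_add] at hcard
    obtain ⟨v, hv⟩ := hpar.exists_forall_dist_le hG hS hcard
    exact ⟨fun _ => v, fun x hx => ⟨i₀, mem_insert_self _ _, hv x hx⟩⟩
  | insert a t ha ih =>
    rcases S.eq_empty_or_nonempty with rfl | hne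
    · exact ⟨fun _ => ρ, fun x hx => absurd hx (notMem_empty x)⟩
    rw [mem_insert, not_or] at hi₀
    rw [sum_insert ha] at hcard
    obtain ⟨v, -, hball, hrest⟩ := hpar.exists_card_sdiff_descendants_le hG hS hne (r a)
    obtain ⟨c, hc⟩ := ih hi₀.2 (mapsTo_sdiff_descendants hS v) (by omega)
    refine ⟨Function.update c a v, fun x hx => ?_⟩
    by_cases hxv : x ∈ descendants par S v
    · exact ⟨a, by simp, by simpa using hball x hxv⟩
    · obtain ⟨i, hi, hdist⟩ := hc x (mem_sdiff.2 ⟨hx, hxv⟩)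
      have hia : i ≠ a := by
        rintro rfl
        exact (mem_insert.1 hi).elim (Ne.symm hi₀.1) ha
      rw [insert_comm]
      exact ⟨i, mem_insert_of_mem hi, by rwa [Function.update_of_ne hia]⟩

theorem two_le_degree_par [G.LocallyFinite] (hpar : IsParentMap G ρ par) {x : V} (hx : x ≠ ρ)
    (hpx : par x ≠ ρ) : 2 ≤ G.degree (par x) := by
  have hne : x ≠ par (par x) := fun h => by
    have hdist := hpar.dist_root hpx
    rw [← h, hpar.dist_root hx] at hdist
    omega
  rw [← card_neighborFinset_eq_degree]
  exact one_lt_card.2 ⟨x, by simpa using hpar.adj hx, _, by simpa using (hpar.adj hpx).symm, hne⟩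

end IsParentMap

end ParentMap

section Degree

variable [Fintype V] [DecidableRel G.Adj]

theorem exists_isParentMap_card_image_le [DecidableEq V] (hG : G.Connected) :
    ∃ ρ par, IsParentMap G ρ par ∧ #(univ.image par) ≤ max 1 #{v | 2 ≤ G.degree v} := by
  obtain ⟨ρ, hρ⟩ : ∃ ρ : V, #(insert ρ ({v | 2 ≤ G.degree v} : Finset V)) ≤
      max 1 #{v | 2 ≤ G.degree v} := by
    rcases ({v | 2 ≤ G.degree v} : Finset V).eq_empty_or_nonempty with hempty | ⟨ρ, hρ⟩
    · exact ⟨hG.nonempty.some, by simp [hempty]⟩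
    · exact ⟨ρ, by simp [insert_eq_of_mem hρ]⟩
  obtain ⟨par, hpar⟩ := exists_isParentMap hG ρ
  refine ⟨ρ, par, hpar, (card_le_card ?_).trans hρ⟩
  refine image_subset_iff.2 fun x _ => ?_
  by_cases hpx : par x = ρ
  · exact mem_insert.2 (Or.inl hpx)
  · have hx : x ≠ ρ := fun h => hpx (h ▸ hpar.map_root)
    exact mem_insert_of_mem (mem_filter.2 ⟨mem_univ _, hpar.two_le_degree_par hx hpx⟩)

theorem burningNumber_le_of_card_two_le_degree (hG : G.Connected) {m : ℕ}
    (h : 2 * #{v | 2 ≤ G.degree v} + 2 < m * (m + 1)) : G.burningNumber ≤ m := by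
  classical
  obtain ⟨k, rfl⟩ : ∃ k, m = k + 2 := Nat.exists_eq_add_of_le' (by by_contra! hm; nlinarith)
  obtain ⟨ρ, par, hpar, hcard⟩ := exists_isParentMap_card_image_le hG
  have hsum : (∑ i ∈ range k, (i + 1)) * 2 = (k + 1) * k := by
    simpa [sum_range_succ'] using sum_range_id_mul_two (k + 1)
  have hcard_le : #(univ.image par) ≤ ∑ i ∈ range k, (i + 1) + (2 * k + 1) := by
    have : (k + 2) * (k + 2 + 1) = (k + 1) * k + 4 * k + 6 := by ring
    omega
  have hmaps : Set.MapsTo par (univ.image par) (univ.image par) := fun x _ =>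
    mem_coe.2 (mem_image_of_mem par (mem_univ x))
  obtain ⟨c, hc⟩ := hpar.exists_centers_dist_le hG id notMem_range_self hmaps hcard_le
  refine burningNumber_le_of_forall_exists_dist_le hG.preconnected (fun i => c (i - 1)) fun x => ?_
  obtain ⟨i, hi, hdist⟩ := hc (par x) (mem_image_of_mem _ (mem_univ x))
  rw [← range_add_one, mem_range] at hi
  refine ⟨i + 1, by omega, ?_⟩
  calc G.dist (c i) x ≤ G.dist (c i) (par x) + G.dist (par x) x := hG.dist_triangle
    _ ≤ i + 1 := Nat.add_le_add hdist (hpar.dist_par_le_one x)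

theorem two_mul_card_two_le_degree_add_card_le (hpos : ∀ v, 0 < G.degree v) :
    2 * #{v | 2 ≤ G.degree v} + Fintype.card V ≤
      #{v | G.degree v = 2} + 2 * #G.edgeFinset := by
  rw [← sum_degrees_eq_twice_card_edges, card_filter, card_filter, mul_sum, Fintype.card,
    card_eq_sum_ones, ← sum_add_distrib, ← sum_add_distrib]
  refine sum_le_sum fun v _ => ?_
  have := hpos v
  split_ifs <;> omega

end Degree

theorem add_lt_ceil_sqrt_mul_succ {n d : ℕ} (hn : 0 < n) (hd : d ≤ ⌊√((n : ℝ) - 1)⌋₊) :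
    n + d < ⌈√(n : ℝ)⌉₊ * (⌈√(n : ℝ)⌉₊ + 1) := by
  have hpos : (0 : ℝ) < n := Nat.cast_pos.2 hn
  have hsq : n ≤ ⌈√(n : ℝ)⌉₊ ^ 2 := by
    exact_mod_cast (Real.sqrt_le_left (Nat.cast_nonneg _)).1 (Nat.le_ceil √(n : ℝ))
  have hlt : ⌊√((n : ℝ) - 1)⌋₊ < ⌈√(n : ℝ)⌉₊ :=
    Nat.floor_lt_ceil_of_lt_of_pos (Real.sqrt_lt_sqrt_iff_of_pos hpos |>.2 (sub_one_lt _))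
      (Real.sqrt_pos.2 hpos)
  calc n + d < ⌈√(n : ℝ)⌉₊ ^ 2 + ⌈√(n : ℝ)⌉₊ := by omega
    _ = ⌈√(n : ℝ)⌉₊ * (⌈√(n : ℝ)⌉₊ + 1) := by ring

end GraphBurning

/-- For a tree, `2 * G.edgeFinset.card + 2` is twice the order, and the hypothesis says that the
order plus the number of vertices of degree `2` is less than `m * (m + 1)`. -/
theorem mainTheorem3_general {V : Type*} [Fintype V] {G : SimpleGraph V} [DecidableRel G.Adj]
    (hG : G.Connected) {m : ℕ}
    (h : 2 * G.edgeFinset.card + (Finset.univ.filter fun v : V => G.degree v = 2).card + 2 <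
      Fintype.card V + m * (m + 1)) :
    G.burningNumber ≤ m := by
  rcases subsingleton_or_nontrivial V with hV | hV
  · have hcard : Fintype.card V ≤ 1 := Fintype.card_le_one_iff_subsingleton.2 hV
    have hm : 0 < m := Nat.pos_of_ne_zero (by rintro rfl; omega)
    exact GraphBurning.burningNumber_le_of_forall_exists_dist_le hG.preconnected
      (fun _ => hG.nonempty.some) fun x => ⟨0, hm, by simp [Subsingleton.elim _ x]⟩
  · have hdeg := GraphBurning.two_mul_card_two_le_degree_add_card_le
      fun v => hG.preconnected.degree_pos_of_nontrivial v
    exact GraphBurning.burningNumber_le_of_card_two_le_degree hG (by omega)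

theorem mainTheorem3 {V : Type*} [Fintype V] (T : SimpleGraph V) [DecidableRel T.Adj]
    (hT : T.IsTree) (n : ℕ) (hn : Fintype.card V = n)
    (hdeg : (Finset.univ.filter (fun v : V => T.degree v = 2)).card ≤ ⌊Real.sqrt ((n : ℝ) - 1)⌋₊) :
    T.burningNumber ≤ (⌈Real.sqrt (n : ℝ)⌉₊ : ℕ∞) := by
  subst hn
  have hcount := GraphBurning.add_lt_ceil_sqrt_mul_succ
    (Fintype.card_pos_iff.2 hT.connected.nonempty) hdeg
  exact mainTheorem3_general hT.connected (by have := hT.card_edgeFinset; omega)
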